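/- Let $K$ be a field of arbitrary characteristic and let $\mathcal A$ be a commutative unital $K$-algebra which is semiprime (that is, has no nonzero nilpotent elements) and has only finitely many minimal prime ideals. Let $\mathcal D(\mathcal A)=\bigcup_{i\ge 0}\mathcal D_i(\mathcal A)\subseteq \mathrm{End}_K(\mathcal A)$ be the algebra of $K$-linear differential operators on $\mathcal A$, where $\mathcal D_{-1}(\mathcal A)=0$ and, for $i\ge 0$, $$\mathcal D_i(\mathcal A)=\{u\in \mathrm{End}_K(\mathcal A) : ru-ur\in \mathcal D_{i-1}(\mathcal A)\text{ for all } r\in \mathcal A\},$$ each $r\in\mathcal A$ being identified with the multiplication map $x\mapsto rx$. Then the algebra $\mathcal D(\mathcal A)$ is simple if and only if $\mathcal A$ is a domain and the algebra $\mathcal D(\mathcal A)$ is simple. (A simple algebra is nonzero and its only two-sided ideals are $0$ and itself.) -/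

import Mathlib

/-- `diffOpsOrderLE K R i` is the space `𝒟ᵢ(R)` of `K`-linear differential operators of order at most
`i` on the commutative `K`-algebra `R`: the `K`-linear maps `u : R → R` with `[r, u] ∈ 𝒟ᵢ₋₁(R)` for
all `r ∈ R`, where `𝒟₋₁(R) = 0` and `r` is identified with the multiplication map `x ↦ r * x`. -/
def diffOpsOrderLE (K R : Type*) [Field K] [CommRing R] [Algebra K R] :
    ℕ → Submodule K (Module.End K R)
  | 0 =>
    { carrier := {u | ∀ r : R, LinearMap.mulLeft K r * u - u * LinearMap.mulLeft K r = 0}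
      zero_mem' := fun r => by simp
      add_mem' := fun {u v} hu hv r => by
        have h := congrArg₂ (· + ·) (hu r) (hv r)
        simp only [add_zero] at h
        rw [← h, mul_add, add_mul]
        abel
      smul_mem' := fun c u hu r => by
        rw [mul_smul_comm, smul_mul_assoc, ← smul_sub, hu r, smul_zero] }
  | i + 1 =>
    { carrier := {u | ∀ r : R,
        LinearMap.mulLeft K r * u - u * LinearMap.mulLeft K r ∈ diffOpsOrderLE K R i}
      zero_mem' := fun r => by simp
      add_mem' := fun {u v} hu hv r => by
        have h := (diffOpsOrderLE K R i).add_mem (hu r) (hv r)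
        convert h using 1
        rw [mul_add, add_mul]
        abel
      smul_mem' := fun c u hu r => by
        rw [mul_smul_comm, smul_mul_assoc, ← smul_sub]
        exact (diffOpsOrderLE K R i).smul_mem c (hu r) }

theorem mem_diffOpsOrderLE_zero {K R : Type*} [Field K] [CommRing R] [Algebra K R]
    {u : Module.End K R} : u ∈ diffOpsOrderLE K R 0 ↔
      ∀ r : R, LinearMap.mulLeft K r * u - u * LinearMap.mulLeft K r = 0 :=
  Iff.rfl

theorem mem_diffOpsOrderLE_succ {K R : Type*} [Field K] [CommRing R] [Algebra K R] {i : ℕ}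
    {u : Module.End K R} : u ∈ diffOpsOrderLE K R (i + 1) ↔
      ∀ r : R, LinearMap.mulLeft K r * u - u * LinearMap.mulLeft K r ∈ diffOpsOrderLE K R i :=
  Iff.rfl

theorem diffOpsOrderLE_mono (K R : Type*) [Field K] [CommRing R] [Algebra K R] :
    Monotone (diffOpsOrderLE K R) := by
  refine monotone_nat_of_le_succ fun i => ?_
  induction i with
  | zero => intro u hu r; rw [hu r]; exact zero_mem _
  | succ i ih => intro u hu r; exact ih (hu r)

theorem mul_mem_diffOpsOrderLE {K R : Type*} [Field K] [CommRing R] [Algebra K R] (i j : ℕ)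
    {u v : Module.End K R} (hu : u ∈ diffOpsOrderLE K R i) (hv : v ∈ diffOpsOrderLE K R j) :
    u * v ∈ diffOpsOrderLE K R (i + j) := by
  have key : ∀ (r : R) (u v : Module.End K R),
      LinearMap.mulLeft K r * (u * v) - u * v * LinearMap.mulLeft K r =
        (LinearMap.mulLeft K r * u - u * LinearMap.mulLeft K r) * v +
          u * (LinearMap.mulLeft K r * v - v * LinearMap.mulLeft K r) := by
    intro r u v
    rw [sub_mul, mul_sub, mul_assoc, mul_assoc, mul_assoc]
    abel
  induction i generalizing j u v with
  | zero =>
    induction j generalizing v with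
    | zero =>
      intro r
      rw [key, hu r, hv r, zero_mul, mul_zero, add_zero]
    | succ j ihj =>
      intro r
      rw [key, hu r, zero_mul, zero_add]
      exact ihj (hv r)
  | succ i ihi =>
    induction j generalizing v with
    | zero =>
      intro r
      rw [key, hv r, mul_zero, add_zero]
      exact ihi 0 (hu r) hv
    | succ j ihj =>
      intro r
      rw [key]
      have h₁ := ihi (j + 1) (hu r) hv
      have h₂ := ihj (hv r)
      rw [show i + (j + 1) = i + 1 + j by omega] at h₁
      exact Submodule.add_mem _ h₁ h₂

/-- The algebra `𝒟(R) = ⋃ᵢ 𝒟ᵢ(R)` of `K`-linear differential operators on the commutative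
`K`-algebra `R`, as a subalgebra of `End_K(R)`; multiplication is composition. -/
def differentialOperators (K R : Type*) [Field K] [CommRing R] [Algebra K R] :
    Subalgebra K (Module.End K R) where
  carrier := {u | ∃ i : ℕ, u ∈ diffOpsOrderLE K R i}
  mul_mem' := by
    rintro u v ⟨i, hu⟩ ⟨j, hv⟩
    exact ⟨i + j, mul_mem_diffOpsOrderLE i j hu hv⟩
  add_mem' := by
    rintro u v ⟨i, hu⟩ ⟨j, hv⟩
    exact ⟨max i j, Submodule.add_mem _ (diffOpsOrderLE_mono K R (le_max_left i j) hu)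
      (diffOpsOrderLE_mono K R (le_max_right i j) hv)⟩
  algebraMap_mem' := fun c => ⟨0, fun r => sub_eq_zero.mpr (Algebra.commutes c _).symm⟩

/-! If `c * x = 0`, then `c * u x` is the commutator of `c` and `u` applied to `x`. The commutator
has lower order, so a power of `c` kills `u x`, and reducedness brings the power down to one. Hence
the operators with image in the annihilator of `c` are closed under left composition too, and form a
two-sided ideal. If `c * a = 0`, this ideal contains multiplication by `a`; simplicity makes it
zero, so `a = 0`, or everything, so `c = 0`. -/

/-- A differential operator of order at most `i` maps the annihilator of `c` into the annihilator of
`c ^ (i + 1)`. -/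
theorem pow_mul_apply_eq_zero_of_mem_diffOpsOrderLE {K R : Type*} [Field K] [CommRing R]
    [Algebra K R] {c x : R} (hx : c * x = 0) {i : ℕ} {u : Module.End K R}
    (hu : u ∈ diffOpsOrderLE K R i) : c ^ (i + 1) * u x = 0 := by
  have comm_apply (u : Module.End K R) :
      (LinearMap.mulLeft K c * u - u * LinearMap.mulLeft K c) x = c * u x := by
    simp [hx]
  induction i generalizing u with
  | zero => rw [zero_add, pow_one, ← comm_apply, hu c, LinearMap.zero_apply]
  | succ i ih => rw [pow_succ, mul_assoc, ← comm_apply, ih (hu c)]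

/-- Over a reduced ring, annihilators of elements are stable under differential operators. -/
theorem mul_apply_eq_zero_of_mem_differentialOperators {K R : Type*} [Field K] [CommRing R]
    [Algebra K R] [IsReduced R] {c x : R} (hx : c * x = 0) {u : Module.End K R}
    (hu : u ∈ differentialOperators K R) : c * u x = 0 := by
  obtain ⟨i, hi⟩ := hu
  refine IsReduced.eq_zero _ ⟨i + 1, ?_⟩
  -- The power `(c * u x) ^ (i + 1)` is a multiple of `c ^ (i + 1) * u x`.
  rw [mul_pow, pow_succ (u x), mul_left_comm, pow_mul_apply_eq_zero_of_mem_diffOpsOrderLE hx hi,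
    mul_zero]

theorem mulLeft_mem_differentialOperators (K : Type*) {R : Type*} [Field K] [CommRing R]
    [Algebra K R] (a : R) : LinearMap.mulLeft K a ∈ differentialOperators K R :=
  ⟨0, fun r => by ext x; simp [mul_left_comm]⟩

/-- The two-sided ideal of differential operators whose image lies in the annihilator of `c`. -/
def diffOpsIntoAnnihilator (K : Type*) {R : Type*} [Field K] [CommRing R] [Algebra K R]
    [IsReduced R] (c : R) : TwoSidedIdeal (differentialOperators K R) :=
  .mk' {u | ∀ x, c * u.1 x = 0}
    (fun x => by simp)
    (fun {u v} hu hv x => by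
      have h := congrArg₂ (· + ·) (hu x) (hv x)
      simpa [mul_add] using h)
    (fun {u} hu x => by simpa using hu x)
    (fun {u v} hv x => mul_apply_eq_zero_of_mem_differentialOperators (hv x) u.2)
    -- Only this closure, under composition on the left, needs `A` reduced: `u` preserves the
    -- annihilator containing `v x`.
    (fun {u v} hu x => hu (v.1 x))

theorem mem_diffOpsIntoAnnihilator {K R : Type*} [Field K] [CommRing R] [Algebra K R]
    [IsReduced R] {c : R} {u : differentialOperators K R} :
    u ∈ diffOpsIntoAnnihilator K c ↔ ∀ x, c * u.1 x = 0 :=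
  TwoSidedIdeal.mem_mk' _ _ _ _ _ _ _

/-- A reduced algebra with simple algebra of differential operators is a domain. -/
theorem isDomain_of_isSimpleRing_differentialOperators (K A : Type*) [Field K] [CommRing A]
    [Algebra K A] [IsReduced A] [IsSimpleRing (differentialOperators K A)] : IsDomain A := by
  have : Nontrivial A := by
    by_contra h
    rw [not_nontrivial_iff_subsingleton] at h
    exact zero_ne_one (α := differentialOperators K A)
      (Subtype.ext (LinearMap.ext fun _ => Subsingleton.elim _ _))
  have : NoZeroDivisors A := by
    refine ⟨fun {c a} hca => ?_⟩
    rcases eq_bot_or_eq_top (diffOpsIntoAnnihilator K c) with h | h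
    · right
      have ha : (⟨_, mulLeft_mem_differentialOperators K a⟩ : differentialOperators K A) ∈
          diffOpsIntoAnnihilator K c :=
        mem_diffOpsIntoAnnihilator.2 fun x => by
          rw [LinearMap.mulLeft_apply, ← mul_assoc, hca, zero_mul]
      rw [h, TwoSidedIdeal.mem_bot] at ha
      simpa using congrArg (fun u : differentialOperators K A => u.1 1) ha
    · left
      -- The identity maps `1` into the annihilator of `c` only if `c = 0`.
      have h1 : (1 : differentialOperators K A) ∈ diffOpsIntoAnnihilator K c := h ▸ trivial
      simpa using mem_diffOpsIntoAnnihilator.1 h1 1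
  exact NoZeroDivisors.to_isDomain A

theorem corollary2p1 (K A : Type*) [Field K] [CommRing A] [Algebra K A] [IsReduced A]
    (hfin : (minimalPrimes A).Finite) :
    IsSimpleRing (differentialOperators K A) ↔
      IsDomain A ∧ IsSimpleRing (differentialOperators K A) :=
  ⟨fun h => ⟨isDomain_of_isSimpleRing_differentialOperators K A, h⟩, And.right⟩
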